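/- Let $F$ be a field (of any characteristic) and let $L$ be a non-abelian nilpotent Lie algebra over $F$ of finite dimension $n$, whose derived subalgebra $L^2=[L,L]$ has dimension $m$. Let $L\otimes L$ be the non-abelian tensor square of $L$ (in the sense of Ellis), that is, the Lie algebra over $F$ generated by the symbols $x\otimes y$ ($x,y\in L$) subject to the relations, for all $c\in F$ and $x,x',y,y'\in L$, \[c(x\otimes y)=cx\otimes y=x\otimes cy,\] \[(x+x')\otimes y=x\otimes y+x'\otimes y,\qquad x\otimes(y+y')=x\otimes y+x\otimes y',\] \[[x,x']\otimes y=x\otimes[x',y]-x'\otimes[x,y],\qquad x\otimes[y,y']=[y',x]\otimes y-[y,x]\otimes y',\] \[[x\otimes y,\,x'\otimes y']=-[y,x]\otimes[x',y'].\] Then $L\otimes L$ is finite-dimensional and \[\dim(L\otimes L)\le (n-m)(n-1)+2.\] Moreover, if $m=1$, then $\dim(L\otimes L)=(n-m)(n-1)+2$ if and only if $L\cong H(1)\oplus A(n-3)$ as Lie algebras over $F$. Here $H(1)$ is the Heisenberg Lie algebra with basis $v_1,v_2,v$, where $[v_1,v_2]=-[v_2,v_1]=v$ and all other brackets of basis elements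 are zero, $A(k)$ is the abelian Lie algebra of dimension $k$ over $F$, and $\oplus$ is the direct sum of Lie algebras. (The hypotheses force $n\ge 3$.) -/

import Mathlib

noncomputable section

/-! ### The non-abelian tensor product of two Lie algebras acting on each other

An action of `M` on `N` (by derivations) is a Lie algebra homomorphism `M → Der N`;
`α m n` stands for `ᵐn` and `β n m` for `ⁿm`. -/

section Tensor

variable {F M N : Type*} [Field F] [LieRing M] [LieAlgebra F M] [LieRing N] [LieAlgebra F N]

/-- The relators of the tensor product, on the symbols `m ⊗ n` (that is, `of F (m, n)`). -/
inductive TensorRelator (α : M →ₗ⁅F⁆ LieDerivation F N N) (β : N →ₗ⁅F⁆ LieDerivation F M M) :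
    FreeLieAlgebra F (M × N) → Prop
  | smul_left (c : F) (m : M) (n : N) : TensorRelator α β
      (c • FreeLieAlgebra.of F (m, n) - FreeLieAlgebra.of F (c • m, n))
  | smul_right (c : F) (m : M) (n : N) : TensorRelator α β
      (c • FreeLieAlgebra.of F (m, n) - FreeLieAlgebra.of F (m, c • n))
  | add_left (m m' : M) (n : N) : TensorRelator α β
      (FreeLieAlgebra.of F (m + m', n)
        - (FreeLieAlgebra.of F (m, n) + FreeLieAlgebra.of F (m', n)))
  | add_right (m : M) (n n' : N) : TensorRelator α β
      (FreeLieAlgebra.of F (m, n + n')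
        - (FreeLieAlgebra.of F (m, n) + FreeLieAlgebra.of F (m, n')))
  | lie_left (m m' : M) (n : N) : TensorRelator α β
      (FreeLieAlgebra.of F (⁅m, m'⁆, n)
        - (FreeLieAlgebra.of F (m, α m' n) - FreeLieAlgebra.of F (m', α m n)))
  | lie_right (m : M) (n n' : N) : TensorRelator α β
      (FreeLieAlgebra.of F (m, ⁅n, n'⁆)
        - (FreeLieAlgebra.of F (β n' m, n) - FreeLieAlgebra.of F (β n m, n')))
  | lie_tmul (m m' : M) (n n' : N) : TensorRelator α β
      (⁅FreeLieAlgebra.of F (m, n), FreeLieAlgebra.of F (m', n')⁆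
        - (-FreeLieAlgebra.of F (β n m, α m' n')))

/-- The Lie ideal of the free Lie algebra generated by the relators. -/
def tensorIdeal (α : M →ₗ⁅F⁆ LieDerivation F N N) (β : N →ₗ⁅F⁆ LieDerivation F M M) :
    LieIdeal F (FreeLieAlgebra F (M × N)) :=
  LieSubmodule.lieSpan F (FreeLieAlgebra F (M × N)) {x | TensorRelator α β x}

/-- The non-abelian tensor product `M ⊗ N`: the Lie algebra generated by the symbols `m ⊗ n`
subject to the relators above. -/
abbrev LieTensor (α : M →ₗ⁅F⁆ LieDerivation F N N) (β : N →ₗ⁅F⁆ LieDerivation F M M) : Type _ :=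
  FreeLieAlgebra F (M × N) ⧸ tensorIdeal α β

end Tensor

/-- The non-abelian tensor square `L ⊗ L`, both actions being `ᵐn = ⁅m, n⁆`. -/
abbrev LieTensorSquare (F L : Type*) [Field F] [LieRing L] [LieAlgebra F L] : Type _ :=
  LieTensor (LieDerivation.ad F L) (LieDerivation.ad F L)

/-! ### The abelian Lie algebra `A(k)` and the Heisenberg Lie algebra `H(k)` -/

/-- The abelian Lie algebra of dimension `k`. -/
def AbelianLie (F : Type*) (k : ℕ) : Type _ := Fin k → F

namespace AbelianLie

variable (F : Type*) [Field F] (k : ℕ)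

instance : AddCommGroup (AbelianLie F k) := inferInstanceAs (AddCommGroup (Fin k → F))

instance : Module F (AbelianLie F k) := inferInstanceAs (Module F (Fin k → F))

instance : LieRing (AbelianLie F k) where
  bracket _ _ := 0
  add_lie _ _ _ := (add_zero 0).symm
  lie_add _ _ _ := (add_zero 0).symm
  lie_self _ := rfl
  leibniz_lie _ _ _ := (add_zero 0).symm

instance : LieAlgebra F (AbelianLie F k) where
  lie_smul c _ _ := (smul_zero c).symm

end AbelianLie

/-- The Heisenberg Lie algebra `H(k)` of dimension `2k + 1`. An element `(a, b, c)` stands for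
`∑ aᵢ v₂ᵢ₋₁ + ∑ bᵢ v₂ᵢ + c v`, where the only non-zero brackets of basis elements are
`⁅v₂ᵢ₋₁, v₂ᵢ⁆ = v = -⁅v₂ᵢ, v₂ᵢ₋₁⁆`. -/
def HeisenbergLie (F : Type*) (k : ℕ) : Type _ := (Fin k → F) × (Fin k → F) × F

namespace HeisenbergLie

@[ext]
theorem ext {F : Type*} {k : ℕ} {x y : HeisenbergLie F k} (h₁ : x.1 = y.1) (h₂ : x.2.1 = y.2.1)
    (h₃ : x.2.2 = y.2.2) : x = y :=
  Prod.ext h₁ (Prod.ext h₂ h₃)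

variable (F : Type*) [Field F] (k : ℕ)

instance : AddCommGroup (HeisenbergLie F k) :=
  inferInstanceAs (AddCommGroup ((Fin k → F) × (Fin k → F) × F))

instance : Module F (HeisenbergLie F k) :=
  inferInstanceAs (Module F ((Fin k → F) × (Fin k → F) × F))

variable {F k}

instance : Bracket (HeisenbergLie F k) (HeisenbergLie F k) where
  bracket x y := ((0, 0, ∑ i, (x.1 i * y.2.1 i - x.2.1 i * y.1 i)) :
    (Fin k → F) × (Fin k → F) × F)

theorem lie_fst (x y : HeisenbergLie F k) : ⁅x, y⁆.1 = 0 := rfl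

theorem lie_snd_fst (x y : HeisenbergLie F k) : ⁅x, y⁆.2.1 = 0 := rfl

theorem lie_snd_snd (x y : HeisenbergLie F k) :
    ⁅x, y⁆.2.2 = ∑ i, (x.1 i * y.2.1 i - x.2.1 i * y.1 i) := rfl

instance : LieRing (HeisenbergLie F k) where
  add_lie x y z := by
    refine ext (add_zero 0).symm (add_zero 0).symm ?_
    change ∑ i, ((x.1 i + y.1 i) * z.2.1 i - (x.2.1 i + y.2.1 i) * z.1 i) =
      ∑ i, (x.1 i * z.2.1 i - x.2.1 i * z.1 i) + ∑ i, (y.1 i * z.2.1 i - y.2.1 i * z.1 i)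
    rw [← Finset.sum_add_distrib]
    exact Finset.sum_congr rfl fun i _ => by ring
  lie_add x y z := by
    refine ext (add_zero 0).symm (add_zero 0).symm ?_
    change ∑ i, (x.1 i * (y.2.1 i + z.2.1 i) - x.2.1 i * (y.1 i + z.1 i)) =
      ∑ i, (x.1 i * y.2.1 i - x.2.1 i * y.1 i) + ∑ i, (x.1 i * z.2.1 i - x.2.1 i * z.1 i)
    rw [← Finset.sum_add_distrib]
    exact Finset.sum_congr rfl fun i _ => by ring
  lie_self x := by
    refine ext rfl rfl ?_
    change ∑ i, (x.1 i * x.2.1 i - x.2.1 i * x.1 i) = 0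
    exact Finset.sum_eq_zero fun i _ => by ring
  leibniz_lie x y z := by
    refine ext (add_zero 0).symm (add_zero 0).symm ?_
    change ⁅x, ⁅y, z⁆⁆.2.2 = ⁅⁅x, y⁆, z⁆.2.2 + ⁅y, ⁅x, z⁆⁆.2.2
    simp [lie_snd_snd, lie_fst, lie_snd_fst]

instance : LieAlgebra F (HeisenbergLie F k) where
  lie_smul c x y := by
    refine ext (smul_zero c).symm (smul_zero c).symm ?_
    change ∑ i, (x.1 i * (c * y.2.1 i) - x.2.1 i * (c * y.1 i)) =
      c * ∑ i, (x.1 i * y.2.1 i - x.2.1 i * y.1 i)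
    rw [Finset.mul_sum]
    exact Finset.sum_congr rfl fun i _ => by ring

end HeisenbergLie

end

/-! Write D = L², let E be a linear complement of D, so dim E = n - m, and let f(x, y) = x ⊗ y. A
bracket of symbols is minus a symbol, so the symbols span L ⊗ L linearly, and the upper bound only
needs the relations linear in the symbols (`IsLiePairing`).

They give f(u, x) = -f(x, u) for x in D (`skew`), hence L ⊗ L = f(E, E) + f(D, L), where the first
summand has dimension at most (n - m)². By nilpotency D is filtered by ideals with one-dimensional
central layers, and each layer adds at most dim E to f(D, L). The top layer, spanned by some ⁅a, b⁆
outside ⁅L, D⁆, adds at most 2, since f(⁅a, b⁆, u) = f(a, ⁅b, u⁆) - f(b, ⁅a, u⁆). The sum is (n -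
m)² + (m - 1)(n - m) + 2 = (n - m)(n - 1) + 2.

Let m = 1. If c, d centralize a, b and ⁅c, d⁆ ≠ 0, then f(D, L) = 0 and the bound is missed by 2.
Otherwise the common centralizer of a and b is abelian, which forces L ≅ H(1) ⊕ A(k). Conversely, an
explicit pairing on H(1) ⊕ A(k) has an image of dimension (k + 2)² + 2. -/

noncomputable section

open Module TensorProduct

/-! ### Ideals of a nilpotent Lie algebra -/

section Ideals

variable {F L : Type*} [Field F] [LieRing L] [LieAlgebra F L]

/-- A vector of an ideal `I` outside `⁅L, I⁆` has a complementary hyperplane in `I` which contains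
`⁅L, I⁆`. -/
theorem LieIdeal.exists_hyperplane {I : LieIdeal F L} {v : L} (hvI : v ∈ I)
    (hv : v ∉ ⁅(⊤ : LieIdeal F L), I⁆) :
    ∃ J : LieIdeal F L, J ≤ I ∧ v ∉ J ∧ (∀ x : L, ∀ i ∈ I, ⁅x, i⁆ ∈ J) ∧
      ∀ i ∈ I, ∃ c : F, i - c • v ∈ J := by
  -- `J` is the kernel on `I` of a functional `g` that kills ⁅L, I⁆ but not `v`; any subspace
  -- between ⁅L, I⁆ and `I` is an ideal.
  obtain ⟨g, hgv, hg⟩ := Submodule.exists_le_ker_of_notMem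
    (p := (⁅(⊤ : LieIdeal F L), I⁆ : LieIdeal F L).toSubmodule) (v := v) hv
  have key : ∀ x : L, ∀ i ∈ I, ⁅x, i⁆ ∈ I ∧ g ⁅x, i⁆ = 0 := fun x i hi =>
    ⟨I.lie_mem hi, hg (LieSubmodule.lie_mem_lie (LieSubmodule.mem_top x) hi)⟩
  refine ⟨{ I.toSubmodule ⊓ LinearMap.ker g with
      lie_mem := fun {x i} hi => key x i hi.1 }, fun i hi => hi.1, fun h => hgv h.2,
      fun x i hi => key x i hi, fun i hi => ⟨g i / g v, ?_, ?_⟩⟩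
  · exact I.sub_mem hi (I.smul_mem _ hvI)
  · simp [div_mul_cancel₀ _ hgv]

/-- Otherwise `I` would lie in every term of the lower central series, one of which is zero. -/
theorem LieIdeal.lie_top_lt [LieRing.IsNilpotent L] {I : LieIdeal F L} (hI : I ≠ ⊥) :
    ¬ I ≤ ⁅(⊤ : LieIdeal F L), I⁆ := by
  intro h
  obtain ⟨k, hk⟩ := (LieModule.isNilpotent_iff F L L).1 inferInstance
  have : ∀ k, I ≤ LieModule.lowerCentralSeries F L L k := by
    intro k
    induction k with
    | zero => exact le_top
    | succ k ih =>
      rw [LieModule.lowerCentralSeries_succ]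
      exact h.trans (LieSubmodule.mono_lie le_rfl ih)
  exact hI (le_bot_iff.1 (hk ▸ this k))

theorem LieIdeal.finrank_lt_of_notMem [FiniteDimensional F L] {I J : LieIdeal F L} (h : J ≤ I)
    {v : L} (hvI : v ∈ I) (hvJ : v ∉ J) : finrank F J < finrank F I :=
  Submodule.finrank_lt_finrank_of_lt (s := J.toSubmodule) (t := I.toSubmodule)
    (lt_of_le_of_ne h fun h' => hvJ (by
      have : v ∈ J.toSubmodule := h' ▸ hvI
      exact this))

/-- A commutator ideal which is not contained in an ideal has a commutator outside it. -/
theorem LieIdeal.exists_lie_notMem {J : LieIdeal F L}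
    (h : ¬ ⁅(⊤ : LieIdeal F L), (⊤ : LieIdeal F L)⁆ ≤ J) : ∃ a b : L, ⁅a, b⁆ ∉ J := by
  by_contra! hJ
  exact h (LieSubmodule.lie_le_iff _ _ _ |>.2 fun a _ b _ => hJ a b)

theorem lie_mem_derived (x y : L) : ⁅x, y⁆ ∈ ⁅(⊤ : LieIdeal F L), (⊤ : LieIdeal F L)⁆ :=
  LieSubmodule.lie_mem_lie (LieSubmodule.mem_top x) (LieSubmodule.mem_top y)

theorem derived_induction {p : L → Prop} (lie : ∀ x y : L, p ⁅x, y⁆) (zero : p 0)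
    (add : ∀ x y, p x → p y → p (x + y)) (smul : ∀ (c : F) x, p x → p (c • x)) {x : L}
    (hx : x ∈ ⁅(⊤ : LieIdeal F L), (⊤ : LieIdeal F L)⁆) : p x := by
  rw [← LieSubmodule.mem_toSubmodule, LieSubmodule.lieIdeal_oper_eq_linear_span'] at hx
  induction hx using Submodule.span_induction with
  | mem x hx => obtain ⟨a, -, b, -, rfl⟩ := hx; exact lie a b
  | zero => exact zero
  | add x y _ _ hx hy => exact add x y hx hy
  | smul c x _ hx => exact smul c x hx

theorem derived_ne_bot (hL : ¬ IsLieAbelian L) :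
    ⁅(⊤ : LieIdeal F L), (⊤ : LieIdeal F L)⁆ ≠ ⊥ := by
  intro h
  refine hL ⟨fun x y => ?_⟩
  have := lie_mem_derived (F := F) x y
  rwa [h, LieSubmodule.mem_bot] at this

end Ideals

theorem Submodule.finrank_map₂_le {F U V W : Type*} [Field F] [AddCommGroup U] [Module F U]
    [AddCommGroup V] [Module F V] [AddCommGroup W] [Module F W] [FiniteDimensional F U]
    [FiniteDimensional F V] (f : U →ₗ[F] V →ₗ[F] W) (p : Submodule F U) (q : Submodule F V) :
    finrank F (Submodule.map₂ f p q) ≤ finrank F p * finrank F q := by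
  rw [TensorProduct.map₂_eq_range_lift_comp_mapIncl, ← Module.finrank_tensorProduct]
  exact LinearMap.finrank_range_le _

theorem finrank_span_singleton_le_one {F V : Type*} [Field F] [AddCommGroup V] [Module F V]
    (v : V) : finrank F (F ∙ v) ≤ 1 :=
  (finrank_span_le_card ({v} : Set V)).trans (by simp)

instance Submodule.finite_map₂ {F U V W : Type*} [Field F] [AddCommGroup U] [Module F U]
    [AddCommGroup V] [Module F V] [AddCommGroup W] [Module F W] [FiniteDimensional F U]
    [FiniteDimensional F V] (f : U →ₗ[F] V →ₗ[F] W) (p : Submodule F U) (q : Submodule F V) :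
    FiniteDimensional F (Submodule.map₂ f p q) := by
  rw [TensorProduct.map₂_eq_range_lift_comp_mapIncl]
  infer_instance

/-! ### Pairings and the upper bound -/

/-- A bilinear map on a Lie algebra satisfying those relations of the tensor square which are
linear in the symbols. -/
structure IsLiePairing {F L W : Type*} [Field F] [LieRing L] [LieAlgebra F L] [AddCommGroup W]
    [Module F W] (f : L →ₗ[F] L →ₗ[F] W) : Prop where
  lie_left (x x' y : L) : f ⁅x, x'⁆ y = f x ⁅x', y⁆ - f x' ⁅x, y⁆
  lie_right (x y y' : L) : f x ⁅y, y'⁆ = f ⁅y', x⁆ y - f ⁅y, x⁆ y'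

namespace IsLiePairing

variable {F L W : Type*} [Field F] [LieRing L] [LieAlgebra F L] [AddCommGroup W] [Module F W]
  {f : L →ₗ[F] L →ₗ[F] W}

/-- Expanding f(⁅p, q⁆, u) by `lie_left` and then `lie_right` yields the cyclic identity f(⁅p, q⁆,
u) + f(⁅q, u⁆, p) + f(⁅u, p⁆, q) = 0. By `lie_right`, its last two terms add up to f(u, ⁅p, q⁆).
Nothing is divided by 2. -/
theorem skew_lie (hf : IsLiePairing f) (p q u : L) : f u ⁅p, q⁆ = -f ⁅p, q⁆ u := by
  have h₁ := hf.lie_left p q u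
  rw [hf.lie_right p q u, hf.lie_right q p u, ← lie_skew u p, ← lie_skew u q,
    ← lie_skew q p] at h₁
  rw [hf.lie_right u p q]
  simp only [map_neg, LinearMap.neg_apply] at h₁ ⊢
  rw [eq_neg_iff_add_eq_zero, ← sub_eq_zero.2 h₁.symm]
  abel

theorem skew (hf : IsLiePairing f) {x : L} (hx : x ∈ ⁅(⊤ : LieIdeal F L), (⊤ : LieIdeal F L)⁆)
    (u : L) : f u x = -f x u := by
  refine derived_induction (p := fun x => f u x = -f x u) (fun p q => hf.skew_lie p q u)
    (by simp) (fun x y hx hy => ?_) (fun c x hx => ?_) hx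
  · rw [map_add, map_add, LinearMap.add_apply, hx, hy, neg_add]
  · rw [map_smul, map_smul, LinearMap.smul_apply, hx, smul_neg]

/-- If `⁅L, z⁆ ⊆ J`, then `z ⊗ L²` is contained in `J ⊗ L`. -/
theorem apply_mem_map₂ (hf : IsLiePairing f) {J : LieIdeal F L} {z : L} (hz : ∀ x : L, ⁅x, z⁆ ∈ J)
    {x : L} (hx : x ∈ ⁅(⊤ : LieIdeal F L), (⊤ : LieIdeal F L)⁆) :
    f z x ∈ Submodule.map₂ f J.toSubmodule ⊤ := by
  refine derived_induction (p := fun x => f z x ∈ Submodule.map₂ f J.toSubmodule ⊤)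
    (fun p q => ?_) (by simp) (fun x y hx hy => ?_) (fun c x hx => ?_) hx
  · rw [hf.lie_right]
    exact Submodule.sub_mem _ (Submodule.apply_mem_map₂ _ (hz _) trivial)
      (Submodule.apply_mem_map₂ _ (hz _) trivial)
  · rw [map_add]; exact Submodule.add_mem _ hx hy
  · rw [map_smul]; exact Submodule.smul_mem _ _ hx

/-- Moving the bracket by `lie_left` turns f(⁅a, b⁆, u) into values f(a, x) and f(b, x) with x in
L². Modulo `J` each such x is a multiple of ⁅a, b⁆, so only two vectors remain. -/
theorem map₂_derived_le (hf : IsLiePairing f) {J : LieIdeal F L} {a b : L}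
    (hJD : J ≤ ⁅(⊤ : LieIdeal F L), (⊤ : LieIdeal F L)⁆)
    (hJ : ∀ i ∈ ⁅(⊤ : LieIdeal F L), (⊤ : LieIdeal F L)⁆, ∃ c : F, i - c • ⁅a, b⁆ ∈ J) :
    Submodule.map₂ f (⁅(⊤ : LieIdeal F L), (⊤ : LieIdeal F L)⁆ : LieIdeal F L).toSubmodule ⊤ ≤
      Submodule.map₂ f J.toSubmodule ⊤ ⊔ (F ∙ f a ⁅a, b⁆ ⊔ F ∙ f b ⁅a, b⁆) := by
  set S := F ∙ f a ⁅a, b⁆ ⊔ F ∙ f b ⁅a, b⁆ with hS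
  have key : ∀ w x : L, f w ⁅a, b⁆ ∈ S → x ∈ ⁅(⊤ : LieIdeal F L), (⊤ : LieIdeal F L)⁆ →
      f w x ∈ Submodule.map₂ f J.toSubmodule ⊤ ⊔ S := by
    intro w x hw hx
    obtain ⟨c, hc⟩ := hJ x hx
    have : f w x = -f (x - c • ⁅a, b⁆) w + c • f w ⁅a, b⁆ := by
      rw [← hf.skew (hJD hc), map_sub, map_smul, sub_add_cancel]
    rw [this]
    exact Submodule.add_mem_sup (Submodule.neg_mem _ (Submodule.apply_mem_map₂ _ hc trivial))
      (Submodule.smul_mem _ _ hw)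
  rw [Submodule.map₂_le]
  rintro i hi u -
  obtain ⟨c, hc⟩ := hJ i hi
  have : f i u = f (i - c • ⁅a, b⁆) u + c • (f a ⁅b, u⁆ - f b ⁅a, u⁆) := by
    rw [← hf.lie_left]
    simp
  rw [this]
  refine Submodule.add_mem _ (Submodule.mem_sup_left (Submodule.apply_mem_map₂ _ hc trivial))
    (Submodule.smul_mem _ _ (Submodule.sub_mem _ (key _ _ ?_ (lie_mem_derived _ _))
      (key _ _ ?_ (lie_mem_derived _ _))))
  · exact Submodule.mem_sup_left (Submodule.mem_span_singleton_self _)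
  · exact Submodule.mem_sup_right (Submodule.mem_span_singleton_self _)

variable [FiniteDimensional F L]

/-- One central layer `I / J` inside `L²` adds at most `dim L / L²` to the dimension. -/
theorem finrank_map₂_layer (hf : IsLiePairing f) {E : Submodule F L}
    (hE : IsCompl (⁅(⊤ : LieIdeal F L), (⊤ : LieIdeal F L)⁆ : LieIdeal F L).toSubmodule E)
    {I J : LieIdeal F L} {v : L} (hv : v ∈ I) (hIJ : ∀ x : L, ∀ i ∈ I, ⁅x, i⁆ ∈ J)
    (hJ : ∀ i ∈ I, ∃ c : F, i - c • v ∈ J) :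
    finrank F (Submodule.map₂ f I.toSubmodule ⊤) ≤
      finrank F (Submodule.map₂ f J.toSubmodule ⊤) + finrank F E := by
  have hle : Submodule.map₂ f I.toSubmodule ⊤ ≤
      Submodule.map₂ f J.toSubmodule ⊤ ⊔ Submodule.map (f v) E := by
    rw [Submodule.map₂_le]
    rintro i hi u -
    obtain ⟨c, hc⟩ := hJ i hi
    have hu : u ∈ (⁅(⊤ : LieIdeal F L), (⊤ : LieIdeal F L)⁆ : LieIdeal F L).toSubmodule ⊔ E := by
      rw [hE.sup_eq_top]; trivial
    obtain ⟨d, hd, e, he, rfl⟩ := Submodule.mem_sup.1 hu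
    -- Only the last term is new: f(v, d) with d in L² already lies in f(J, L), because ⁅L, v⁆ ⊆ J.
    have : f i (d + e) = f (i - c • v) (d + e) + c • f v d + c • f v e := by
      simp only [map_sub, LinearMap.sub_apply, map_smul, LinearMap.smul_apply, map_add]
      abel
    rw [this]
    refine Submodule.add_mem_sup (Submodule.add_mem _ (Submodule.apply_mem_map₂ _ hc trivial)
      (Submodule.smul_mem _ _ (hf.apply_mem_map₂ (fun x => hIJ x v hv) hd)))
      (Submodule.smul_mem _ _ (Submodule.mem_map_of_mem he))
  have h1 := Submodule.finrank_mono hle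
  have h2 := Submodule.finrank_add_le_finrank_add_finrank (Submodule.map₂ f J.toSubmodule ⊤)
    (Submodule.map (f v) E)
  have h3 := Submodule.finrank_map_le (f v) E
  omega

theorem finrank_map₂_ideal_le [LieRing.IsNilpotent L] (hf : IsLiePairing f) {E : Submodule F L}
    (hE : IsCompl (⁅(⊤ : LieIdeal F L), (⊤ : LieIdeal F L)⁆ : LieIdeal F L).toSubmodule E)
    (I : LieIdeal F L) :
    finrank F (Submodule.map₂ f I.toSubmodule ⊤) ≤ finrank F I * finrank F E := by
  induction hk : finrank F I using Nat.strong_induction_on generalizing I with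
  | _ k ih =>
    by_cases hI : I = ⊥
    · subst hI
      rw [LieSubmodule.bot_toSubmodule, Submodule.map₂_bot_left, finrank_bot]
      exact Nat.zero_le _
    · obtain ⟨v, hvI, hv⟩ := SetLike.not_le_iff_exists.1 (LieIdeal.lie_top_lt hI)
      obtain ⟨J, hJI, hvJ, hIJ, hJ⟩ := LieIdeal.exists_hyperplane hvI hv
      have hlt := LieIdeal.finrank_lt_of_notMem hJI hvI hvJ
      have h₁ := ih _ (hk ▸ hlt) J rfl
      have h₂ := hf.finrank_map₂_layer hE hvI hIJ hJ
      have h₃ := Nat.mul_le_mul_right (finrank F E) (Nat.succ_le_of_lt (hk ▸ hlt))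
      rw [Nat.succ_mul] at h₃
      omega

/-- The layer-by-layer estimate is used only on a hyperplane `J` of L²; the top layer, generated by
a commutator, costs 2 in place of dim E. -/
theorem finrank_map₂_derived_le [LieRing.IsNilpotent L] (hf : IsLiePairing f)
    (hL : ¬ IsLieAbelian L) {E : Submodule F L}
    (hE : IsCompl (⁅(⊤ : LieIdeal F L), (⊤ : LieIdeal F L)⁆ : LieIdeal F L).toSubmodule E) :
    finrank F (Submodule.map₂ f
        (⁅(⊤ : LieIdeal F L), (⊤ : LieIdeal F L)⁆ : LieIdeal F L).toSubmodule ⊤) ≤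
      (finrank F ↥⁅(⊤ : LieIdeal F L), (⊤ : LieIdeal F L)⁆ - 1) * finrank F E + 2 := by
  obtain ⟨a, b, hab⟩ := LieIdeal.exists_lie_notMem
    (LieIdeal.lie_top_lt (derived_ne_bot (F := F) hL))
  have hab' := lie_mem_derived (F := F) a b
  obtain ⟨J, hJD, hvJ, hIJ, hJ⟩ := LieIdeal.exists_hyperplane hab' hab
  have hlt := LieIdeal.finrank_lt_of_notMem hJD hab' hvJ
  have h₁ := Submodule.finrank_mono (hf.map₂_derived_le hJD hJ)
  have h₂ := Submodule.finrank_add_le_finrank_add_finrank (Submodule.map₂ f J.toSubmodule ⊤)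
    (F ∙ f a ⁅a, b⁆ ⊔ F ∙ f b ⁅a, b⁆)
  have h₃ := Submodule.finrank_add_le_finrank_add_finrank (F ∙ f a ⁅a, b⁆) (F ∙ f b ⁅a, b⁆)
  have h₄ := finrank_span_singleton_le_one (F := F) (f a ⁅a, b⁆)
  have h₅ := finrank_span_singleton_le_one (F := F) (f b ⁅a, b⁆)
  have h₆ := hf.finrank_map₂_ideal_le hE J
  have h₇ := Nat.mul_le_mul_right (finrank F E) (Nat.le_sub_one_of_lt hlt)
  omega

theorem finrank_map₂_top_le (hf : IsLiePairing f) {E : Submodule F L}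
    (hE : IsCompl (⁅(⊤ : LieIdeal F L), (⊤ : LieIdeal F L)⁆ : LieIdeal F L).toSubmodule E) :
    finrank F (Submodule.map₂ f ⊤ ⊤) ≤ finrank F E * finrank F E + finrank F (Submodule.map₂ f
        (⁅(⊤ : LieIdeal F L), (⊤ : LieIdeal F L)⁆ : LieIdeal F L).toSubmodule ⊤) := by
  set D := (⁅(⊤ : LieIdeal F L), (⊤ : LieIdeal F L)⁆ : LieIdeal F L).toSubmodule with hD
  have hle : Submodule.map₂ f ⊤ ⊤ ≤ Submodule.map₂ f E E ⊔ Submodule.map₂ f D ⊤ := by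
    have hmem : ∀ u, ∃ d ∈ D, ∃ e ∈ E, d + e = u := fun u =>
      Submodule.mem_sup.1 (by rw [hE.sup_eq_top]; trivial)
    rw [Submodule.map₂_le]
    rintro u - w -
    obtain ⟨d, hd, e, he, rfl⟩ := hmem u
    obtain ⟨d', hd', e', he', rfl⟩ := hmem w
    -- The mixed term f(e, d') is moved into f(L², L) by skew-symmetry.
    have : f (d + e) (d' + e') = f e e' + (f d (d' + e') - f d' e) := by
      rw [sub_eq_add_neg, ← hf.skew (x := d') hd']
      simp only [map_add, LinearMap.add_apply]
      abel
    rw [this]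
    exact Submodule.add_mem_sup (Submodule.apply_mem_map₂ _ he he') (Submodule.sub_mem _
      (Submodule.apply_mem_map₂ _ hd trivial) (Submodule.apply_mem_map₂ _ hd' trivial))
  have h₁ := Submodule.finrank_mono hle
  have h₂ := Submodule.finrank_add_le_finrank_add_finrank (Submodule.map₂ f E E)
    (Submodule.map₂ f D ⊤)
  have h₃ := Submodule.finrank_map₂_le f E E
  omega

end IsLiePairing

/-! ### The tensor square: spanning by symbols and lifting of pairings -/

namespace LieTensorSquare

variable {F L : Type*} [Field F] [LieRing L] [LieAlgebra F L]

theorem mk_eq_mk {u v : FreeLieAlgebra F (L × L)}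
    (h : TensorRelator (LieDerivation.ad F L) (LieDerivation.ad F L) (u - v)) :
    (LieSubmodule.Quotient.mk u : LieTensorSquare F L) = LieSubmodule.Quotient.mk v := by
  rw [← sub_eq_zero]
  exact (LieSubmodule.Quotient.mk_eq_zero' (m := u - v)).2 (LieSubmodule.subset_lieSpan h)

variable (F L) in
/-- The bilinear map `(x, y) ↦ x ⊗ y`. -/
def tmul : L →ₗ[F] L →ₗ[F] LieTensorSquare F L :=
  LinearMap.mk₂ F (fun x y => LieSubmodule.Quotient.mk (FreeLieAlgebra.of F (x, y)))
    (fun x x' y => mk_eq_mk (.add_left x x' y))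
    (fun c x y => (mk_eq_mk (.smul_left c x y)).symm)
    (fun x y y' => mk_eq_mk (.add_right x y y'))
    (fun c x y => (mk_eq_mk (.smul_right c x y)).symm)

variable (F L) in
theorem isLiePairing_tmul : IsLiePairing (tmul F L) where
  lie_left x x' y := by
    have h := mk_eq_mk (TensorRelator.lie_left (α := LieDerivation.ad F L)
      (β := LieDerivation.ad F L) x x' y)
    simp only [LieDerivation.ad_apply_apply] at h
    exact h
  lie_right x y y' := by
    have h := mk_eq_mk (TensorRelator.lie_right (α := LieDerivation.ad F L)
      (β := LieDerivation.ad F L) x y y')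
    simp only [LieDerivation.ad_apply_apply] at h
    exact h

theorem lie_tmul (x y x' y' : L) :
    ⁅tmul F L x y, tmul F L x' y'⁆ = -tmul F L ⁅y, x⁆ ⁅x', y'⁆ :=
  by
    have h := mk_eq_mk (TensorRelator.lie_tmul (α := LieDerivation.ad F L)
      (β := LieDerivation.ad F L) x x' y y')
    simp only [LieDerivation.ad_apply_apply] at h
    exact h

/-- The span of the symbols, as a Lie subalgebra. -/
def spanTmul : LieSubalgebra F (LieTensorSquare F L) where
  __ := Submodule.map₂ (tmul F L) ⊤ ⊤
  lie_mem' := by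
    intro u v hu hv
    simp only [AddSubsemigroup.mem_carrier, AddSubmonoid.mem_toSubsemigroup,
      Submodule.mem_toAddSubmonoid] at hu hv ⊢
    have h : ∀ x y x' y' : L, ⁅tmul F L x y, tmul F L x' y'⁆ ∈ Submodule.map₂ (tmul F L) ⊤ ⊤ :=
      fun x y x' y' => by
        rw [lie_tmul]
        exact Submodule.neg_mem _ (Submodule.apply_mem_map₂ _ trivial trivial)
    rw [Submodule.map₂_eq_span_image2] at hu hv
    induction hu, hv using Submodule.span_induction₂ with
    | mem_mem u v hu hv =>
      obtain ⟨x, -, y, -, rfl⟩ := hu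
      obtain ⟨x', -, y', -, rfl⟩ := hv
      exact h x y x' y'
    | zero_left v _ => rw [zero_lie]; exact Submodule.zero_mem _
    | zero_right v _ => rw [lie_zero]; exact Submodule.zero_mem _
    | add_left _ _ _ _ _ _ h₁ h₂ => rw [add_lie]; exact Submodule.add_mem _ h₁ h₂
    | add_right _ _ _ _ _ _ h₁ h₂ => rw [lie_add]; exact Submodule.add_mem _ h₁ h₂
    | smul_left _ _ _ _ _ h₁ => rw [smul_lie]; exact Submodule.smul_mem _ _ h₁
    | smul_right _ _ _ _ _ h₁ => rw [lie_smul]; exact Submodule.smul_mem _ _ h₁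

/-- The symbols span the tensor square linearly. -/
theorem map₂_tmul_top : Submodule.map₂ (tmul F L) ⊤ ⊤ = ⊤ := by
  refine Submodule.eq_top_iff'.2 fun t => ?_
  obtain ⟨u, rfl⟩ := LieSubmodule.Quotient.surjective_mk' _ t
  let g : FreeLieAlgebra F (L × L) →ₗ⁅F⁆ spanTmul (F := F) (L := L) :=
    FreeLieAlgebra.lift F fun p =>
      ⟨tmul F L p.1 p.2, Submodule.apply_mem_map₂ (tmul F L) trivial trivial⟩
  let π : FreeLieAlgebra F (L × L) →ₗ⁅F⁆ LieTensorSquare F L :=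
    { (LieSubmodule.Quotient.mk' (tensorIdeal (LieDerivation.ad F L) (LieDerivation.ad F L)) :
        FreeLieAlgebra F (L × L) →ₗ[F] LieTensorSquare F L) with
      map_lie' := fun {x y} => LieSubmodule.Quotient.mk_bracket _ x y }
  -- The quotient map and `g` agree on the free generators, so the quotient map takes values in the
  -- span of the symbols.
  have h : (spanTmul (F := F) (L := L)).incl.comp g = π := by
    refine FreeLieAlgebra.hom_ext fun p => ?_
    change ((g (FreeLieAlgebra.of F p) : spanTmul (F := F) (L := L)) : LieTensorSquare F L) = _
    rw [FreeLieAlgebra.lift_of_apply]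
    rfl
  have := (g u).2
  have e : ((g u : spanTmul (F := F) (L := L)) : LieTensorSquare F L) = π u :=
    LieHom.congr_fun h u
  rw [e] at this
  exact this

instance [FiniteDimensional F L] : FiniteDimensional F (LieTensorSquare F L) := by
  have := Submodule.finite_map₂ (tmul F L) ⊤ ⊤
  rw [map₂_tmul_top] at this
  exact Module.finite_def.2 ((Submodule.fg_top _).1 (Module.finite_def.1 this))

theorem finrank_eq : finrank F (LieTensorSquare F L) =
    finrank F (Submodule.map₂ (tmul F L) ⊤ ⊤) := by
  rw [map₂_tmul_top, finrank_top]

/-- A pairing with values in an abelian Lie algebra, vanishing on `L² × L²`, factors through the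
tensor square. -/
theorem exists_lift {A : Type*} [LieRing A] [LieAlgebra F A] [IsLieAbelian A]
    {f : L →ₗ[F] L →ₗ[F] A} (hf : IsLiePairing f)
    (hD : ∀ x y x' y' : L, f ⁅x, y⁆ ⁅x', y'⁆ = 0) :
    ∃ g : LieTensorSquare F L →ₗ[F] A, ∀ x y, g (tmul F L x y) = f x y := by
  let g : FreeLieAlgebra F (L × L) →ₗ⁅F⁆ A := FreeLieAlgebra.lift F fun p => f p.1 p.2
  have hg : ∀ x y, g (FreeLieAlgebra.of F (x, y)) = f x y := fun x y =>
    FreeLieAlgebra.lift_of_apply _ _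
  have hker : tensorIdeal (LieDerivation.ad F L) (LieDerivation.ad F L) ≤ g.ker := by
    refine LieSubmodule.lieSpan_le.2 fun u hu => ?_
    rw [SetLike.mem_coe, LieHom.mem_ker]
    cases hu with
    | smul_left c m n => simp [hg]
    | smul_right c m n => simp [hg]
    | add_left m m' n => simp [hg]
    | add_right m n n' => simp [hg]
    | lie_left m m' n => simp [hg, hf.lie_left m m' n]
    | lie_right m n n' => simp [hg, hf.lie_right m n n']
    -- In the only non-linear relator the bracket dies because `A` is abelian, the other term by
    -- `hD`.
    | lie_tmul m m' n n' => simp [hg, hD, LieHom.map_lie, trivial_lie_zero]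
  exact ⟨Submodule.liftQ _ (g : FreeLieAlgebra F (L × L) →ₗ[F] A) hker, hg⟩

/-- This is the source of lower bounds: `W` with the zero bracket is an abelian target for the lift
of `f`. -/
theorem finrank_map₂_le [FiniteDimensional F L] {W : Type*} [AddCommGroup W] [Module F W]
    {f : L →ₗ[F] L →ₗ[F] W} (hf : IsLiePairing f)
    (hD : ∀ x y x' y' : L, f ⁅x, y⁆ ⁅x', y'⁆ = 0) :
    finrank F (Submodule.map₂ f ⊤ ⊤) ≤ finrank F (LieTensorSquare F L) := by
  let _ : LieRing W :=
    { bracket := fun _ _ => 0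
      add_lie := fun _ _ _ => (add_zero 0).symm
      lie_add := fun _ _ _ => (add_zero 0).symm
      lie_self := fun _ => rfl
      leibniz_lie := fun _ _ _ => (add_zero 0).symm }
  let _ : LieAlgebra F W := { lie_smul := fun c _ _ => (smul_zero c).symm }
  have : IsLieAbelian W := ⟨fun _ _ => rfl⟩
  obtain ⟨g, hg⟩ := exists_lift hf hD
  refine (Submodule.finrank_mono ?_).trans (LinearMap.finrank_range_le g)
  exact Submodule.map₂_le.2 fun x _ y _ => ⟨_, hg x y⟩

end LieTensorSquare

/-! ### The pairing attaining the bound -/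

namespace HeisenbergLie

variable (F : Type*) [Field F] (k : ℕ)

/-- The projection of `H(1) ⊕ A(k)` onto its abelianization. -/
def abCoord : (HeisenbergLie F 1 × AbelianLie F k) →ₗ[F] F × F × (Fin k → F) where
  toFun x := (x.1.1 0, x.1.2.1 0, x.2)
  map_add' _ _ := rfl
  map_smul' _ _ := rfl

/-- The coordinate on the derived subalgebra of `H(1) ⊕ A(k)`. -/
def centralCoord : (HeisenbergLie F 1 × AbelianLie F k) →ₗ[F] F where
  toFun x := x.1.2.2
  map_add' _ _ := rfl
  map_smul' _ _ := rfl

variable {F k}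

theorem abCoord_lie (x y : HeisenbergLie F 1 × AbelianLie F k) : abCoord F k ⁅x, y⁆ = 0 := rfl

theorem centralCoord_lie (x y : HeisenbergLie F 1 × AbelianLie F k) :
    centralCoord F k ⁅x, y⁆ = (abCoord F k x).1 * (abCoord F k y).2.1 -
      (abCoord F k x).2.1 * (abCoord F k y).1 :=
  (lie_snd_snd x.1 y.1).trans (Fin.sum_univ_one _)

variable (F k)

/-- The pairing which realizes the tensor square of `H(1) ⊕ A(k)`. -/
def pairing : (HeisenbergLie F 1 × AbelianLie F k) →ₗ[F] (HeisenbergLie F 1 × AbelianLie F k)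
    →ₗ[F] ((F × F × (Fin k → F)) ⊗[F] (F × F × (Fin k → F))) × F × F :=
  LinearMap.mk₂ F
    -- The two scalar coordinates detect v ⊗ v₁ and v ⊗ v₂, skew-symmetrized as `skew` requires.
    (fun x y => (abCoord F k x ⊗ₜ abCoord F k y,
      centralCoord F k x * (abCoord F k y).1 - (abCoord F k x).1 * centralCoord F k y,
      centralCoord F k x * (abCoord F k y).2.1 - (abCoord F k x).2.1 * centralCoord F k y))
    (fun x x' y => by
      simp only [map_add, TensorProduct.add_tmul, Prod.fst_add, Prod.snd_add, Prod.mk_add_mk]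
      congr 2 <;> ring)
    (fun c x y => by
      simp only [map_smul, TensorProduct.smul_tmul', Prod.smul_fst, Prod.smul_snd, Prod.smul_mk,
        smul_eq_mul]
      congr 2 <;> ring)
    (fun x y y' => by
      simp only [map_add, TensorProduct.tmul_add, Prod.fst_add, Prod.snd_add, Prod.mk_add_mk]
      congr 2 <;> ring)
    (fun c x y => by
      simp only [map_smul, TensorProduct.tmul_smul, Prod.smul_fst, Prod.smul_snd, Prod.smul_mk,
        smul_eq_mul]
      congr 2 <;> ring)

variable {F k}

theorem pairing_apply (x y : HeisenbergLie F 1 × AbelianLie F k) :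
    pairing F k x y = (abCoord F k x ⊗ₜ abCoord F k y,
      centralCoord F k x * (abCoord F k y).1 - (abCoord F k x).1 * centralCoord F k y,
      centralCoord F k x * (abCoord F k y).2.1 - (abCoord F k x).2.1 * centralCoord F k y) :=
  rfl

theorem isLiePairing_pairing : IsLiePairing (pairing F k) where
  lie_left x x' y := by
    simp only [pairing_apply, abCoord_lie, centralCoord_lie, TensorProduct.zero_tmul,
      TensorProduct.tmul_zero, Prod.mk_sub_mk, sub_self, Prod.fst_zero, Prod.snd_zero]
    congr 2 <;> ring
  lie_right x y y' := by
    simp only [pairing_apply, abCoord_lie, centralCoord_lie, TensorProduct.zero_tmul,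
      TensorProduct.tmul_zero, Prod.mk_sub_mk, sub_self, Prod.fst_zero, Prod.snd_zero]
    congr 2 <;> ring

theorem pairing_lie_lie (x y x' y' : HeisenbergLie F 1 × AbelianLie F k) :
    pairing F k ⁅x, y⁆ ⁅x', y'⁆ = 0 := by
  rw [pairing_apply, abCoord_lie, abCoord_lie]
  simp only [TensorProduct.zero_tmul, Prod.fst_zero, Prod.snd_zero, mul_zero, zero_mul, sub_self]
  rfl

theorem exists_coord (v : F × F × (Fin k → F)) (c : F) :
    ∃ x, abCoord F k x = v ∧ centralCoord F k x = c :=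
  ⟨(((fun _ => v.1, fun _ => v.2.1, c) : (Fin 1 → F) × (Fin 1 → F) × F), v.2.2), rfl, rfl⟩

theorem map₂_pairing : Submodule.map₂ (pairing F k) ⊤ ⊤ = ⊤ := by
  have h : ∀ x y, pairing F k x y ∈ Submodule.map₂ (pairing F k) ⊤ ⊤ := fun x y =>
    Submodule.apply_mem_map₂ _ trivial trivial
  have h₁ : ∀ t, (t, 0, 0) ∈ Submodule.map₂ (pairing F k) ⊤ ⊤ := by
    intro t
    induction t using TensorProduct.induction_on with
    | zero => exact Submodule.zero_mem _
    | tmul v w =>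
      obtain ⟨x, hx, hx'⟩ := exists_coord v 0
      obtain ⟨y, hy, hy'⟩ := exists_coord w 0
      simpa [pairing_apply, hx, hx', hy, hy'] using h x y
    | add s t hs ht => simpa using Submodule.add_mem _ hs ht
  -- `z` is the central element v of H(1); pairing it with c v₁ + d v₂ gives (0, c, d).
  obtain ⟨z, hz, hz'⟩ := exists_coord (k := k) (0 : F × F × (Fin k → F)) 1
  refine Submodule.eq_top_iff'.2 fun ⟨t, c, d⟩ => ?_
  obtain ⟨x, hx, hx'⟩ := exists_coord (k := k) ((c, d, 0) : F × F × (Fin k → F)) 0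
  have := Submodule.add_mem _ (h₁ t) (h z x)
  simpa [pairing_apply, hx, hx', hz, hz'] using this

end HeisenbergLie

/-! ### Lower bound and recognition of H(1) ⊕ A(k) -/

section Structure

variable {F L : Type*} [Field F] [LieRing L] [LieAlgebra F L]

theorem IsLiePairing.comp {L' W : Type*} [LieRing L'] [LieAlgebra F L'] [AddCommGroup W]
    [Module F W] {f : L' →ₗ[F] L' →ₗ[F] W} (hf : IsLiePairing f) (e : L →ₗ⁅F⁆ L') :
    IsLiePairing (f.compl₁₂ (e : L →ₗ[F] L') (e : L →ₗ[F] L')) where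
  lie_left x x' y := by simp [hf.lie_left]
  lie_right x y y' := by simp [hf.lie_right]

theorem finrank_heisenberg_prod (k : ℕ) :
    finrank F (HeisenbergLie F 1 × AbelianLie F k) = k + 3 := by
  change finrank F (((Fin 1 → F) × (Fin 1 → F) × F) × (Fin k → F)) = k + 3
  simp
  omega

theorem Submodule.map₂_compl₁₂_top {U V W : Type*} [AddCommGroup U] [Module F U]
    [AddCommGroup V] [Module F V] [AddCommGroup W] [Module F W] (f : V →ₗ[F] V →ₗ[F] W)
    {e : U →ₗ[F] V} (he : Function.Surjective e) :
    Submodule.map₂ (f.compl₁₂ e e) ⊤ ⊤ = Submodule.map₂ f ⊤ ⊤ := by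
  refine le_antisymm (Submodule.map₂_le.2 fun x _ y _ =>
    Submodule.apply_mem_map₂ f trivial trivial) (Submodule.map₂_le.2 fun x _ y _ => ?_)
  obtain ⟨x, rfl⟩ := he x
  obtain ⟨y, rfl⟩ := he y
  exact Submodule.apply_mem_map₂ (f.compl₁₂ e e) trivial trivial

/-- Here k + 2 is the dimension of the abelianization of H(1) ⊕ A(k); the final 2 comes from the
scalar coordinates of the pairing. -/
theorem le_finrank_tensorSquare [FiniteDimensional F L] {k : ℕ}
    (e : L →ₗ⁅F⁆ HeisenbergLie F 1 × AbelianLie F k) (he : Function.Surjective e) :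
    (k + 2) * (k + 2) + 2 ≤ finrank F (LieTensorSquare F L) := by
  have h := LieTensorSquare.finrank_map₂_le (HeisenbergLie.isLiePairing_pairing.comp e)
    fun x y x' y' => by
      rw [LinearMap.compl₁₂_apply]
      exact (congrArg₂ (fun u v => HeisenbergLie.pairing F k u v) (e.map_lie x y)
        (e.map_lie x' y')).trans (HeisenbergLie.pairing_lie_lie _ _ _ _)
  rw [Submodule.map₂_compl₁₂_top _ he, HeisenbergLie.map₂_pairing, finrank_top] at h
  refine le_trans (le_of_eq ?_) h
  simp only [finrank_prod, finrank_tensorProduct, finrank_self, finrank_fin_fun]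
  ring

/-- The Lie subalgebra spanned by `a`, `b`, `⁅a, b⁆` and a central subspace, as an image of
`H(1) ⊕ A(k)`. -/
def heisenbergHom {a b : L} (hz : ∀ x : L, ⁅x, ⁅a, b⁆⁆ = 0) {k : ℕ} (e : (Fin k → F) →ₗ[F] L)
    (he : ∀ (x : L) v, ⁅x, e v⁆ = 0) : HeisenbergLie F 1 × AbelianLie F k →ₗ⁅F⁆ L where
  toFun x := x.1.1 0 • a + x.1.2.1 0 • b + x.1.2.2 • ⁅a, b⁆ + e x.2
  map_add' x y := by
    have : ∀ (r s t r' s' t' : F) (v v' : Fin k → F), (r + r') • a + (s + s') • b +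
      (t + t') • ⁅a, b⁆ + e (v + v') = r • a + s • b + t • ⁅a, b⁆ + e v +
        (r' • a + s' • b + t' • ⁅a, b⁆ + e v') := by
      intros; rw [map_add]; module
    exact this ..
  map_smul' c x := by
    have : ∀ (r s t : F) (v : Fin k → F), (c * r) • a + (c * s) • b +
      (c * t) • ⁅a, b⁆ + e (c • v) = c • (r • a + s • b + t • ⁅a, b⁆ + e v) := by
      intros; rw [map_smul]; module
    exact this ..
  map_lie' := by
    intro x y
    have hz' : ∀ y : L, ⁅⁅a, b⁆, y⁆ = 0 := fun y => by rw [← lie_skew, hz, neg_zero]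
    have hba : ⁅b, a⁆ = -⁅a, b⁆ := (lie_skew b a).symm
    have he' : ∀ v (y : L), ⁅e v, y⁆ = 0 := fun v y => by rw [← lie_skew, he, neg_zero]
    have : ∀ (r s t r' s' t' : F) (v v' : Fin k → F),
        (0 : F) • a + (0 : F) • b + (r * s' - s * r') • ⁅a, b⁆ + e 0 =
        ⁅r • a + s • b + t • ⁅a, b⁆ + e v, r' • a + s' • b + t' • ⁅a, b⁆ + e v'⁆ := by
      intros
      simp only [add_lie, lie_add, smul_lie, lie_smul, hz, hz', he, he', lie_self, hba, map_zero]
      module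
    have h := this (x.1.1 0) (x.1.2.1 0) x.1.2.2 (y.1.1 0) (y.1.2.1 0) y.1.2.2 x.2 y.2
    refine Eq.trans ?_ h
    rw [← Fin.sum_univ_one (fun i => x.1.1 i * y.1.2.1 i - x.1.2.1 i * y.1.1 i)]
    rfl

/-- A Lie algebra whose derived subalgebra is spanned by a central commutator `⁅a, b⁆`, and in
which the common centralizer of `a` and `b` is abelian, is `H(1) ⊕ A(k)`. -/
theorem exists_equiv_heisenberg_prod [FiniteDimensional F L] {a b : L} (hab : ⁅a, b⁆ ≠ 0)
    (hz : ∀ x : L, ⁅x, ⁅a, b⁆⁆ = 0) (hspan : ∀ x y : L, ∃ c : F, ⁅x, y⁆ = c • ⁅a, b⁆)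
    (hC : ∀ c d : L, ⁅a, c⁆ = 0 → ⁅b, c⁆ = 0 → ⁅a, d⁆ = 0 → ⁅b, d⁆ = 0 → ⁅c, d⁆ = 0) :
    ∃ k, Nonempty (L ≃ₗ⁅F⁆ HeisenbergLie F 1 × AbelianLie F k) := by
  let C : Submodule F L := LinearMap.ker (LieAlgebra.ad F L a : L →ₗ[F] L) ⊓
    LinearMap.ker (LieAlgebra.ad F L b : L →ₗ[F] L)
  have hCmem : ∀ x, x ∈ C ↔ ⁅a, x⁆ = 0 ∧ ⁅b, x⁆ = 0 := fun x => Iff.rfl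
  -- L = Fa + Fb + C: the coefficients are read off from ⁅x, b⁆ = r⁅a, b⁆ and ⁅a, x⁆ = s⁅a, b⁆. As
  -- `C` is abelian, it is then central.
  have hdec : ∀ x : L, ∃ r s : F, x - (r • a + s • b) ∈ C := by
    intro x
    obtain ⟨r, hr⟩ := hspan x b
    obtain ⟨s, hs⟩ := hspan a x
    refine ⟨r, s, ?_⟩
    rw [hCmem]
    have hba : ⁅b, a⁆ = -⁅a, b⁆ := (lie_skew b a).symm
    simp only [lie_sub, lie_add, lie_smul, lie_self, ← lie_skew b x, hba, hr, hs]
    constructor <;> module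
  have hcent : ∀ c ∈ C, ∀ x : L, ⁅x, c⁆ = 0 := by
    intro c hc x
    obtain ⟨r, s, h⟩ := hdec x
    have : ⁅x, c⁆ = ⁅x - (r • a + s • b), c⁆ + (r • ⁅a, c⁆ + s • ⁅b, c⁆) := by
      simp only [sub_lie, add_lie, smul_lie]; abel
    rw [this, hC _ _ h.1 h.2 hc.1 hc.2, ((hCmem c).1 hc).1, ((hCmem c).1 hc).2]
    simp
  -- Since ⁅a, b⁆ lies in `C`, intersecting with `C` gives a complement of its line inside `C`: the
  -- abelian factor.
  obtain ⟨E, hE⟩ := Submodule.exists_isCompl (F ∙ ⁅a, b⁆)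
  let A : Submodule F L := C ⊓ E
  let θ : (Fin (finrank F A) → F) ≃ₗ[F] A := (Module.finBasis F A).equivFun.symm
  let e : (Fin (finrank F A) → F) →ₗ[F] L := A.subtype ∘ₗ θ.toLinearMap
  have he : ∀ v, e v ∈ A := fun v => (θ v).2
  let Φ := heisenbergHom hz e fun x v => hcent _ (he v).1 x
  refine ⟨_, ⟨(LieEquiv.ofBijective Φ ⟨?_, fun x => ?_⟩).symm⟩⟩
  · rw [injective_iff_map_eq_zero]
    intro x hx
    have hx' : x.1.1 0 • a + x.1.2.1 0 • b + x.1.2.2 • ⁅a, b⁆ + e x.2 = 0 := hx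
    -- Bracketing with `b` and with `a` isolates the coefficients of `a` and of `b`.
    have h₁ := congrArg (fun u => ⁅u, b⁆) hx'
    have h₂ := congrArg (fun u => ⁅a, u⁆) hx'
    have hcb : ∀ c ∈ C, ⁅c, b⁆ = 0 := fun c hc => by rw [← lie_skew, hcent c hc, neg_zero]
    have hzb : ⁅⁅a, b⁆, b⁆ = 0 := by rw [← lie_skew, hz, neg_zero]
    simp only [add_lie, smul_lie, lie_self, hzb, hcb _ (he x.2).1, zero_lie, smul_zero, add_zero,
      smul_eq_zero, hab, or_false] at h₁
    simp only [lie_add, lie_smul, lie_self, hz, hcent _ (he x.2).1, lie_zero, smul_zero, add_zero,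
      zero_add, smul_eq_zero, hab, or_false] at h₂
    rw [h₁, h₂, zero_smul, zero_smul, zero_add, zero_add] at hx'
    have h₃ : e x.2 = 0 := by
      refine Submodule.disjoint_def.1 hE.disjoint _ ?_ (he x.2).2
      rw [eq_neg_of_add_eq_zero_right hx']
      exact Submodule.neg_mem _ (Submodule.smul_mem _ _ (Submodule.mem_span_singleton_self _))
    rw [h₃, add_zero, smul_eq_zero, or_iff_left hab] at hx'
    have h₄ : θ x.2 = 0 := Subtype.ext h₃
    refine Prod.ext (HeisenbergLie.ext (funext fun i => ?_) (funext fun i => ?_) hx') ?_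
    · rw [Subsingleton.elim i 0]; exact h₁
    · rw [Subsingleton.elim i 0]; exact h₂
    · exact (LinearEquiv.map_eq_zero_iff θ).1 h₄
  · obtain ⟨r, s, h⟩ := hdec x
    have hu : x - (r • a + s • b) ∈ F ∙ ⁅a, b⁆ ⊔ E := by rw [hE.sup_eq_top]; trivial
    obtain ⟨d, hd, w, hw, hdw⟩ := Submodule.mem_sup.1 hu
    obtain ⟨t, rfl⟩ := Submodule.mem_span_singleton.1 hd
    have hwA : w ∈ A := by
      refine ⟨?_, hw⟩
      have hzC : ⁅a, b⁆ ∈ C := ⟨hz a, hz b⟩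
      rw [← hdw] at h
      exact (Submodule.add_mem_iff_right _ (Submodule.smul_mem _ _ hzC)).1 h
    refine ⟨(((fun _ => r, fun _ => s, t) : (Fin 1 → F) × (Fin 1 → F) × F), θ.symm ⟨w, hwA⟩), ?_⟩
    have hew : e (θ.symm ⟨w, hwA⟩) = w := by
      change ((θ (θ.symm ⟨w, hwA⟩) : A) : L) = w
      rw [LinearEquiv.apply_symm_apply]
    change r • a + s • b + t • ⁅a, b⁆ + e (θ.symm ⟨w, hwA⟩) = x
    rw [hew, add_assoc, hdw]
    abel

end Structure

/-! ### The case of a one-dimensional derived subalgebra -/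

section Extremal

variable {F L : Type*} [Field F] [LieRing L] [LieAlgebra F L]

/-- If the derived subalgebra is one-dimensional, it is spanned by a central commutator. -/
theorem exists_lie_spanning [FiniteDimensional F L] [LieRing.IsNilpotent L]
    (hL : ¬ IsLieAbelian L)
    (hm : finrank F ↥⁅(⊤ : LieIdeal F L), (⊤ : LieIdeal F L)⁆ = 1) :
    ∃ a b : L, ⁅a, b⁆ ≠ 0 ∧ (∀ x : L, ⁅x, ⁅a, b⁆⁆ = 0) ∧
      ∀ i ∈ ⁅(⊤ : LieIdeal F L), (⊤ : LieIdeal F L)⁆, ∃ c : F, i = c • ⁅a, b⁆ := by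
  obtain ⟨a, b, hab⟩ := LieIdeal.exists_lie_notMem
    (LieIdeal.lie_top_lt (derived_ne_bot (F := F) hL))
  have hab' := lie_mem_derived (F := F) a b
  obtain ⟨J, hJD, hvJ, hIJ, hJ⟩ := LieIdeal.exists_hyperplane hab' hab
  have hlt := LieIdeal.finrank_lt_of_notMem hJD hab' hvJ
  rw [hm, Nat.lt_one_iff] at hlt
  have hJ0 : J.toSubmodule = ⊥ := Submodule.finrank_eq_zero.1 hlt
  have hmem : ∀ x, x ∈ J → x = 0 := fun x hx => by
    rw [← LieSubmodule.mem_toSubmodule, hJ0] at hx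
    exact hx
  refine ⟨a, b, fun h => hvJ (h ▸ J.zero_mem), fun x => hmem _ (hIJ x _ hab'), fun i hi => ?_⟩
  obtain ⟨c, hc⟩ := hJ i hi
  exact ⟨c, sub_eq_zero.1 (hmem _ hc)⟩

/-- If `L²` is spanned by `⁅a, b⁆`, and by a commutator of elements centralizing `a` and `b`, then
a pairing vanishes on `L² × L`. -/
theorem IsLiePairing.map₂_derived_eq_bot {W : Type*} [AddCommGroup W] [Module F W]
    {f : L →ₗ[F] L →ₗ[F] W} (hf : IsLiePairing f) {a b c d : L}
    (hspan : ∀ i ∈ ⁅(⊤ : LieIdeal F L), (⊤ : LieIdeal F L)⁆, ∃ r : F, i = r • ⁅a, b⁆)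
    (hac : ⁅a, c⁆ = 0) (hbc : ⁅b, c⁆ = 0) (had : ⁅a, d⁆ = 0) (hbd : ⁅b, d⁆ = 0)
    (hcd : ⁅c, d⁆ ≠ 0) :
    Submodule.map₂ f
      (⁅(⊤ : LieIdeal F L), (⊤ : LieIdeal F L)⁆ : LieIdeal F L).toSubmodule ⊤ = ⊥ := by
  obtain ⟨r, hr⟩ := hspan _ (lie_mem_derived c d)
  have hr0 : r ≠ 0 := by
    rintro rfl
    exact hcd (by rw [hr, zero_smul])
  -- ⁅a, b⁆ is proportional to ⁅c, d⁆, and f(w, ⁅c, d⁆) = f(⁅d, w⁆, c) - f(⁅c, w⁆, d). Taking w = a,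
  -- b kills both generators left by `map₂_derived_le` with J = 0.
  have key : ∀ w : L, ⁅w, c⁆ = 0 → ⁅w, d⁆ = 0 → f w ⁅a, b⁆ = 0 := by
    intro w hwc hwd
    have h : f w ⁅c, d⁆ = 0 := by
      rw [hf.lie_right, ← lie_skew d w, ← lie_skew c w, hwc, hwd]
      simp
    rw [hr, map_smul] at h
    exact (smul_eq_zero.1 h).resolve_left hr0
  have h := hf.map₂_derived_le (J := ⊥) (a := a) (b := b) bot_le fun i hi => by
    obtain ⟨s, hs⟩ := hspan i hi
    exact ⟨s, by rw [hs, sub_self]; exact LieSubmodule.zero_mem _⟩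
  rw [key a hac had, key b hbc hbd, LieSubmodule.bot_toSubmodule, Submodule.map₂_bot_left,
    Submodule.span_zero_singleton, sup_bot_eq, sup_bot_eq] at h
  exact le_bot_iff.1 h

end Extremal

end

/-! ### The main theorem -/

theorem theorem3p4 {F L : Type*} [Field F] [LieRing L] [LieAlgebra F L] [FiniteDimensional F L]
    [LieRing.IsNilpotent L] (hL : ¬ IsLieAbelian L) (n m : ℕ)
    (hn : Module.finrank F L = n)
    (hm : Module.finrank F ↥⁅(⊤ : LieIdeal F L), (⊤ : LieIdeal F L)⁆ = m) :
    FiniteDimensional F (LieTensorSquare F L) ∧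
    (Module.finrank F (LieTensorSquare F L) : ℤ) ≤ ((n : ℤ) - m) * ((n : ℤ) - 1) + 2 ∧
    (m = 1 →
      ((Module.finrank F (LieTensorSquare F L) : ℤ) = ((n : ℤ) - m) * ((n : ℤ) - 1) + 2 ↔
        Nonempty (L ≃ₗ⁅F⁆ HeisenbergLie F 1 × AbelianLie F (n - 3)))) := by
  obtain ⟨E, hE⟩ := Submodule.exists_isCompl
    (⁅(⊤ : LieIdeal F L), (⊤ : LieIdeal F L)⁆ : LieIdeal F L).toSubmodule
  have hf := LieTensorSquare.isLiePairing_tmul F L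
  have hEn : m + Module.finrank F E = n := by
    rw [← hn, ← hm]
    exact Submodule.finrank_add_eq_of_isCompl hE
  have hm0 : 0 < m := by
    rw [← hm, Nat.pos_iff_ne_zero]
    intro h
    exact derived_ne_bot (F := F) hL
      ((LieSubmodule.toSubmodule_eq_bot _).1 (Submodule.finrank_eq_zero.1 h))
  have h₁ := hf.finrank_map₂_top_le hE
  rw [← LieTensorSquare.finrank_eq] at h₁
  have h₂ := hf.finrank_map₂_derived_le hL hE
  rw [hm] at h₂
  have hbound : (Module.finrank F (LieTensorSquare F L) : ℤ) ≤
      ((n : ℤ) - m) * ((n : ℤ) - 1) + 2 := by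
    -- With m = k + 1 the truncated m - 1 becomes k, and n - 1 = dim E + k.
    obtain ⟨k, rfl⟩ := Nat.exists_eq_add_of_le' hm0
    have h₃ := h₁.trans (Nat.add_le_add_left h₂ _)
    rw [Nat.add_sub_cancel] at h₃
    have h₄ : (Module.finrank F (LieTensorSquare F L) : ℤ) ≤
        Module.finrank F E * Module.finrank F E + (k * Module.finrank F E + 2) := by
      exact_mod_cast h₃
    refine h₄.trans (le_of_eq ?_)
    rw [← hEn]
    push_cast
    ring
  refine ⟨inferInstance, hbound, ?_⟩
  rintro rfl
  constructor
  · intro heq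
    obtain ⟨a, b, hab, hz, hspan⟩ := exists_lie_spanning hL hm
    obtain ⟨k, ⟨e⟩⟩ := exists_equiv_heisenberg_prod hab hz
      (fun x y => hspan _ (lie_mem_derived x y)) fun c d hac hbc had hbd => by
        -- Vanishing of f(L², L) would give (n - 1)² + 2 ≤ (n - 1)².
        by_contra hcd
        rw [hf.map₂_derived_eq_bot hspan hac hbc had hbd hcd, finrank_bot, add_zero] at h₁
        have h₄ : (Module.finrank F (LieTensorSquare F L) : ℤ) ≤
            Module.finrank F E * Module.finrank F E := by
          exact_mod_cast h₁
        rw [heq, ← hEn] at h₄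
        push_cast at h₄
        ring_nf at h₄
        linarith
    have hk := e.toLinearEquiv.finrank_eq
    rw [finrank_heisenberg_prod, hn] at hk
    rw [hk, Nat.add_sub_cancel]
    exact ⟨e⟩
  · rintro ⟨e⟩
    -- Comparing dimensions gives n = (n - 3) + 3, so the subtraction in ℕ is not truncated.
    have hk := e.toLinearEquiv.finrank_eq
    rw [finrank_heisenberg_prod, hn] at hk
    have h₃ := le_finrank_tensorSquare e.toLieHom e.surjective
    refine le_antisymm hbound ?_
    have h₄ : (((n - 3 : ℕ) : ℤ) + 2) * (((n - 3 : ℕ) : ℤ) + 2) + 2 ≤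
        Module.finrank F (LieTensorSquare F L) := by exact_mod_cast h₃
    have h₅ : (n : ℤ) = ((n - 3 : ℕ) : ℤ) + 3 := by exact_mod_cast hk
    refine le_trans (le_of_eq ?_) h₄
    rw [h₅, Nat.cast_one]
    ring
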